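/- All graphs are finite and simple. The unit sphere $S(x)$ of a vertex $x$ of $G$ is the subgraph of $G$ induced by the neighbours of $x$. A graph is contractible if it is the one-point graph or if it has a vertex $x$ such that both $S(x)$ and $G-x$ are contractible. Two graphs are homotopic if one can be transformed into the other (up to isomorphism) by finitely many steps, each of which deletes a vertex $x$ whose unit sphere $S(x)$ is contractible, or reverses such a deletion. The standard $d$-sphere ($d\ge 0$) is the cross-polytope graph: the complement of the disjoint union of $d+1$ copies of $K_2$. A wedge sum of $m$ $d$-spheres is obtained from $m$ disjoint copies of it by identifying one vertex of each copy. The Zykov join of a family of graphs is their disjoint union together with all edges between vertices of different members. The length of a path graph or cycle graph is its number of edges (so a path graph of length $\ell\ge 0$ has $\ell+1$ vertices, and a cycle graph of length $n\ge 3$ has $n$ vertices). **Corollary (complements of disjoint unions of paths and cycles).** The graph complement of a disjoint union of graphs is the Zykov join of their graph complements. Let $G$ be the disjoint union of finitely many, and at least one, path graphs of lengths $\ell_1,\dots,\ell_p\ge 0$ and cycle graphs of lengths $n_1,\dots,n_q\ge 3$. 1. If none of the lengths $\ell_i$, $n_j$ is divisible by $3$, then the graph complement $\overline G$ is homotopic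 to a $d$-sphere, where $d\ge 0$ is given by $$d+1=\sum_{i=1}^p\left\lfloor\frac{\ell_i+2}{3}\right\rfloor+\sum_{j=1}^q\left\lfloor\frac{n_j+1}{3}\right\rfloor .$$ 2. If some path length $\ell_i$ is divisible by $3$, then $\overline G$ is contractible. 3. If no path length $\ell_i$ is divisible by $3$, and $c$ of the cycle lengths $n_j$ are divisible by $3$, then $\overline G$ is homotopic to a wedge sum of $2^c$ $d$-spheres, with the same formula for $d$. In particular $\overline G$ is always contractible, or homotopic to a sphere or to a wedge sum of spheres. -/

import Mathlib

universe u v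

namespace GraphHomotopy

/-- The unit sphere `S(x)`: the subgraph induced on the neighbours of `x`. -/
abbrev unitSphere {V : Type u} (G : SimpleGraph V) (x : V) : SimpleGraph (G.neighborSet x) :=
  G.induce (G.neighborSet x)

/-- The graph `G - x` obtained by deleting the vertex `x`. -/
abbrev deleteVertex {V : Type u} (G : SimpleGraph V) (x : V) :
    SimpleGraph ({x}ᶜ : Set V) :=
  G.induce ({x}ᶜ : Set V)

/-- Contractible graphs: a one-point graph is contractible, and `G` is contractible if for some
vertex `x` both the unit sphere `S(x)` and `G - x` are contractible. A contractible graph is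
automatically finite and non-empty. -/
inductive Contractible : {V : Type u} → SimpleGraph V → Prop
  | point {V : Type u} (G : SimpleGraph V) (x : V) (h : ∀ y, y = x) : Contractible G
  | step {V : Type u} (G : SimpleGraph V) (x : V)
      (hS : Contractible (unitSphere G x)) (hD : Contractible (deleteVertex G x)) :
      Contractible G

/-- Homotopy of graphs: the equivalence relation generated by graph isomorphism and by the
homotopy reductions `G ↦ G - x`, which are allowed when the unit sphere `S(x)` is contractible.
(The reverse of a reduction is, up to isomorphism, a homotopy extension: adding a new vertex and
connecting it to all vertices of a contractible induced subgraph.) -/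
inductive Homotopic : {V W : Type u} → SimpleGraph V → SimpleGraph W → Prop
  | iso {V W : Type u} {G : SimpleGraph V} {H : SimpleGraph W} (e : G ≃g H) : Homotopic G H
  | reduction {V : Type u} (G : SimpleGraph V) (x : V) (hS : Contractible (unitSphere G x)) :
      Homotopic G (deleteVertex G x)
  | symm {V W : Type u} {G : SimpleGraph V} {H : SimpleGraph W} (h : Homotopic G H) :
      Homotopic H G
  | trans {U V W : Type u} {F : SimpleGraph U} {G : SimpleGraph V} {H : SimpleGraph W}
      (h₁ : Homotopic F G) (h₂ : Homotopic G H) : Homotopic F H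

/-- The standard `d`-sphere: the cross-polytope graph on `2 (d + 1)` vertices, which are grouped
into `d + 1` antipodal pairs; two vertices are adjacent unless they are equal or antipodal. -/
abbrev sphere (d : ℕ) : SimpleGraph (Fin (d + 1) × Fin 2) :=
  SimpleGraph.completeEquipartiteGraph (d + 1) 2

/-- The wedge sum of `m` copies of the graph `H`, glued together at the vertex `w`. The vertex
`none` is the common base point, `some (i, a)` is the vertex `a ≠ w` of the `i`-th copy. -/
def wedgeCopies {W : Type u} (m : ℕ) (H : SimpleGraph W) (w : W) :
    SimpleGraph (Option (Fin m × {a : W // a ≠ w})) where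
  Adj x y :=
    match x, y with
    | none, none => False
    | none, some b => H.Adj w b.2
    | some a, none => H.Adj a.2 w
    | some a, some b => a.1 = b.1 ∧ H.Adj a.2 b.2
  symm := ⟨by
    intro x y h
    match x, y, h with
    | none, some _, h => exact SimpleGraph.Adj.symm h
    | some _, none, h => exact SimpleGraph.Adj.symm h
    | some _, some _, h => exact ⟨h.1.symm, SimpleGraph.Adj.symm h.2⟩⟩
  loopless := ⟨by
    intro x h
    match x, h with
    | some _, h => exact H.loopless.irrefl _ h.2⟩

/-- The wedge sum of `m` copies of the standard `d`-sphere. -/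
abbrev wedgeOfSpheres (m d : ℕ) :
    SimpleGraph (Option (Fin m × {a : Fin (d + 1) × Fin 2 // a ≠ (0, 0)})) :=
  wedgeCopies m (sphere d) (0, 0)

/-- The disjoint union of a family of graphs. -/
def disjointUnion {ι : Type u} {V : ι → Type v} (H : ∀ i, SimpleGraph (V i)) :
    SimpleGraph (Σ i, V i) where
  Adj x y := ∃ (i : ι) (a b : V i), x = ⟨i, a⟩ ∧ y = ⟨i, b⟩ ∧ (H i).Adj a b
  symm := ⟨fun _ _ ⟨i, a, b, hx, hy, h⟩ => ⟨i, b, a, hy, hx, h.symm⟩⟩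
  loopless := ⟨by
    rintro _ ⟨i, a, b, rfl, hy, h⟩
    obtain rfl : a = b := by simpa using hy
    exact (H i).loopless.irrefl _ h⟩

/-- The Zykov join of a family of graphs: the disjoint union together with all edges between
vertices of different members of the family. -/
def zykovJoin {ι : Type u} {V : ι → Type v} (H : ∀ i, SimpleGraph (V i)) :
    SimpleGraph (Σ i, V i) :=
  disjointUnion H ⊔ SimpleGraph.completeMultipartiteGraph V

/-- A path of length `l` (that is, with `l` edges, `l ≥ 0`), or a cycle of length `n ≥ 3`. -/
inductive PathOrCycle : Type
  | path (l : ℕ) : PathOrCycle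
  | cycle (n : ℕ) (hn : 3 ≤ n) : PathOrCycle

namespace PathOrCycle

/-- The length, which is the number of edges. -/
def length : PathOrCycle → ℕ
  | path l => l
  | cycle n _ => n

/-- The number of vertices. -/
def order : PathOrCycle → ℕ
  | path l => l + 1
  | cycle n _ => n

/-- Being a path. -/
def IsPath : PathOrCycle → Prop
  | path _ => True
  | cycle _ _ => False

/-- Being a cycle. -/
def IsCycle : PathOrCycle → Prop
  | path _ => False
  | cycle _ _ => True

/-- The graph: the path graph with `l + 1` vertices or the cycle graph with `n` vertices. -/
def graph : (K : PathOrCycle) → SimpleGraph (Fin K.order)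
  | path l => SimpleGraph.pathGraph (l + 1)
  | cycle n _ => SimpleGraph.cycleGraph n

/-- The contribution of a component to `d + 1`: it is `⌈l / 3⌉` for a path of length `l`, and the
integer nearest to `n / 3` for a cycle of length `n`. -/
def weight : PathOrCycle → ℕ
  | path l => (l + 2) / 3
  | cycle n _ => (n + 1) / 3

end PathOrCycle

end GraphHomotopy

/-! Complementation turns the disjoint union into a join, so the components can be treated one at a
time. In the complement of a path on `n + 3` vertices, vertex 2 is dominated by vertex 0; deleting
it leaves the suspension of the complement of the path on `n` vertices
(`compl_pathGraph_homotopic`). After two homotopy-preserving edge additions the same happens for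
cycles (`compl_cycleGraph_homotopic`). Hence each component reduces by threes, and every step
suspends the remaining join.

The end cases decide the type. A path reduced to one vertex makes the join a cone. A component
reduced to two isolated points gives one more suspension. A cycle reduced to three isolated points
gives a suspension that also doubles the number of spheres.

What carries this is `attach_homotopic_wedgeSusp`: attaching independent vertices with links
isomorphic to `L` to a contractible graph gives a wedge of suspensions of `L`, wherever the links
lie. The join of a graph with such a wedge has this shape again, and for three points each link is
first split in two by `homotopic_split`. -/

namespace GraphHomotopy
open SimpleGraph

/-! ### Induced subgraphs, deletions and dominated vertices -/

/-- An embedding whose range is `s` is an isomorphism onto the subgraph induced on `s`. -/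
noncomputable def isoInduceOfRange {A V : Type*} {H : SimpleGraph A} {G : SimpleGraph V}
    (f : H ↪g G) {s : Set V} (hs : Set.range f = s) : H ≃g G.induce s :=
  hs ▸ f.isoInduceRange

/-- The inclusion of an induced subgraph into a larger induced subgraph. -/
def induceInduce {V : Type*} (G : SimpleGraph V) {s t : Set V} (h : t ⊆ s) :
    G.induce t ↪g G.induce s where
  toFun x := ⟨x, h x.2⟩
  inj' x y hxy := by simpa [Subtype.ext_iff] using hxy
  map_rel_iff' := Iff.rfl

theorem range_induceInduce {V : Type*} (G : SimpleGraph V) {s t : Set V} (h : t ⊆ s) :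
    Set.range (induceInduce G h) = Subtype.val ⁻¹' t := by
  ext y
  exact ⟨fun ⟨x, hx⟩ => hx ▸ x.2, fun hy => ⟨⟨y, hy⟩, rfl⟩⟩

namespace Contractible

theorem of_iso {V W : Type u} {G : SimpleGraph V} {H : SimpleGraph W} (h : Contractible G)
    (e : G ≃g H) : Contractible H := by
  induction h generalizing W with
  | point G x hx =>
    exact .point H (e x) fun y => by rw [← hx (e.symm y)]; simp
  | step G x _ _ ihS ihD =>
    refine .step H (e x) (ihS ?_) (ihD ?_)
    · refine isoInduceOfRange ((Embedding.induce _).trans e.toEmbedding) ?_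
      ext y
      constructor
      · rintro ⟨z, rfl⟩
        simpa using e.map_adj_iff.2 z.2
      · intro hy
        exact ⟨⟨e.symm y, by
          rw [mem_neighborSet, ← e.map_adj_iff]; simpa using hy⟩, by simp⟩
    · refine isoInduceOfRange ((Embedding.induce _).trans e.toEmbedding) ?_
      ext y
      constructor
      · rintro ⟨z, rfl⟩
        exact fun h => z.2 (e.injective h)
      · intro hy
        refine ⟨⟨e.symm y, ?_⟩, by simp⟩
        rintro rfl
        simp at hy

/-- Contractibility of `G.induce s` from the deletion of a vertex `x ∈ s`. -/
theorem induce_step {V : Type u} {G : SimpleGraph V} {s : Set V} {x : V} (hx : x ∈ s)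
    (hS : Contractible (G.induce (G.neighborSet x ∩ s)))
    (hD : Contractible (G.induce (s \ {x}))) : Contractible (G.induce s) := by
  refine .step _ ⟨x, hx⟩ (hS.of_iso ?_) (hD.of_iso ?_)
  · refine isoInduceOfRange (induceInduce G Set.inter_subset_right) ?_
    ext ⟨y, hy⟩
    simp [range_induceInduce]
  · refine isoInduceOfRange (induceInduce G Set.sdiff_subset) ?_
    ext ⟨y, hy⟩
    simp [range_induceInduce]

/-- A finite cone is contractible. -/
theorem of_apex {V : Type u} [Finite V] {G : SimpleGraph V} (a : V)
    (ha : ∀ b, b ≠ a → G.Adj a b) : Contractible G := by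
  obtain ⟨n, hn⟩ : ∃ n, Nat.card V = n := ⟨_, rfl⟩
  induction n using Nat.strong_induction_on generalizing V with
  | _ n ih =>
  by_cases h : ∀ y, y = a
  · exact .point G a h
  push Not at h
  obtain ⟨x, hx⟩ := h
  have hlt : ∀ s : Set V, x ∉ s → Nat.card s < n := by
    intro s hs
    rw [← hn, Nat.card_coe_set_eq]
    exact Set.ncard_lt_card fun h => hs (h.symm ▸ Set.mem_univ x)
  -- For `x ≠ a`, both the unit sphere of `x` and `G - x` are smaller cones with apex `a`.
  refine .step G x ?_ ?_
  · exact ih _ (hlt _ (by simp)) ⟨a, (ha x hx).symm⟩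
      (fun b hb => ha b fun h => hb (Subtype.ext h)) rfl
  · exact ih _ (hlt _ (by simp)) ⟨a, fun h => hx h.symm⟩
      (fun b hb => ha b fun h => hb (Subtype.ext h)) rfl

theorem induce_of_apex {V : Type u} [Finite V] {G : SimpleGraph V} {s : Set V} {a : V}
    (ha : a ∈ s) (h : ∀ b ∈ s, b ≠ a → G.Adj a b) : Contractible (G.induce s) :=
  of_apex ⟨a, ha⟩ fun b hb => h b b.2 fun h => hb (Subtype.ext h)

end Contractible

theorem Homotopic.refl {V : Type u} (G : SimpleGraph V) : Homotopic G G := .iso .refl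

/-- Deleting a vertex `x ∈ s` with contractible unit sphere from `G.induce s`. -/
theorem Homotopic.induce_diff_singleton {V : Type u} {G : SimpleGraph V} {s : Set V} {x : V}
    (hx : x ∈ s) (hS : Contractible (G.induce (G.neighborSet x ∩ s))) :
    Homotopic (G.induce s) (G.induce (s \ {x})) := by
  refine .trans (.reduction _ ⟨x, hx⟩ (hS.of_iso ?_)) (.symm (.iso ?_))
  · refine isoInduceOfRange (induceInduce G Set.inter_subset_right) ?_
    ext ⟨y, hy⟩
    simp [range_induceInduce]
  · refine isoInduceOfRange (induceInduce G Set.sdiff_subset) ?_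
    ext ⟨y, hy⟩
    simp [range_induceInduce]

/-- Deletion of a finite set of vertices whose unit spheres stay contractible during the
deletion. -/
theorem Homotopic.induce_diff {V : Type u} {G : SimpleGraph V} {s t : Set V} (ht : t.Finite)
    (h : ∀ v ∈ t, ∀ r ⊆ t, Contractible (G.induce (G.neighborSet v ∩ (s \ r)))) :
    Homotopic (G.induce s) (G.induce (s \ t)) := by
  induction t, ht using Set.Finite.induction_on with
  | empty => rw [Set.sdiff_empty]; exact .refl _
  | @insert a t ha ht ih =>
    refine .trans (ih fun v hv r hr => h v (.inr hv) r (hr.trans (Set.subset_insert _ _))) ?_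
    by_cases has : a ∈ s
    · rw [show s \ insert a t = (s \ t) \ {a} by ext; simp; tauto]
      exact .induce_diff_singleton ⟨has, ha⟩ (h a (.inl rfl) t (Set.subset_insert _ _))
    · rw [show s \ insert a t = s \ t by
        ext y; rcases eq_or_ne y a with rfl | hy <;> simp_all]
      exact .refl _

theorem Contractible.of_induce_diff {V : Type u} {G : SimpleGraph V} {s t : Set V}
    (ht : t.Finite)
    (h : ∀ v ∈ t, ∀ r ⊆ t, Contractible (G.induce (G.neighborSet v ∩ (s \ r))))
    (hD : Contractible (G.induce (s \ t))) : Contractible (G.induce s) := by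
  induction t, ht using Set.Finite.induction_on with
  | empty => rwa [Set.sdiff_empty] at hD
  | @insert a t ha ht ih =>
    refine ih (fun v hv r hr => h v (.inr hv) r (hr.trans (Set.subset_insert _ _))) ?_
    by_cases has : a ∈ s
    · rw [show s \ insert a t = (s \ t) \ {a} by ext; simp; tauto] at hD
      exact .induce_step ⟨has, ha⟩ (h a (.inl rfl) t (Set.subset_insert _ _)) hD
    · rwa [show s \ insert a t = s \ t by
        ext y; rcases eq_or_ne y a with rfl | hy <;> simp_all] at hD

section Embeddings
variable {A V : Type u} {H : SimpleGraph A} {G : SimpleGraph V} (f : H ↪g G)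

theorem homotopic_of_embedding_aux {t : Set V} (ht : t.Finite) (hf : Set.range f = tᶜ)
    (h : ∀ v ∈ t, ∀ r ⊆ t, Contractible (G.induce (G.neighborSet v ∩ rᶜ))) :
    Homotopic G H := by
  refine .trans (.symm (.iso (induceUnivIso G))) (.trans (.induce_diff ht (fun v hv r hr => by
    rw [← Set.compl_eq_univ_sdiff]; exact h v hv r hr)) (.symm (.iso (isoInduceOfRange f ?_))))
  rw [hf, Set.compl_eq_univ_sdiff]

theorem contractible_of_embedding_aux {t : Set V} (ht : t.Finite) (hf : Set.range f = tᶜ)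
    (h : ∀ v ∈ t, ∀ r ⊆ t, Contractible (G.induce (G.neighborSet v ∩ rᶜ)))
    (hH : Contractible H) : Contractible G := by
  refine .of_iso ?_ (induceUnivIso G)
  refine .of_induce_diff ht (fun v hv r hr => by
    rw [← Set.compl_eq_univ_sdiff]; exact h v hv r hr)
    (hH.of_iso (isoInduceOfRange f ?_))
  rw [hf, Set.compl_eq_univ_sdiff]

/-- The dominating vertex lies in the range of `f` and is never deleted, so it stays an apex of the
unit sphere of `v` whichever vertices have already gone. -/
theorem contractible_inter_of_dominated [Finite V]
    (h : ∀ v ∉ Set.range f, ∃ a, G.Adj v (f a) ∧ ∀ z, G.Adj v z → z ≠ f a → G.Adj (f a) z) :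
    ∀ v ∈ (Set.range f)ᶜ, ∀ r ⊆ (Set.range f)ᶜ,
      Contractible (G.induce (G.neighborSet v ∩ rᶜ)) := by
  intro v hv r hr
  obtain ⟨a, ha, h⟩ := h v hv
  exact .induce_of_apex ⟨ha, fun har => hr har ⟨a, rfl⟩⟩ fun b hb hba => h b hb.1 hba

/-- If every vertex outside an induced subgraph `H` of `G` is dominated by a vertex of `H`, then
`G` is homotopic to `H`. -/
theorem homotopic_of_dominated [Finite V]
    (h : ∀ v ∉ Set.range f, ∃ a, G.Adj v (f a) ∧ ∀ z, G.Adj v z → z ≠ f a → G.Adj (f a) z) :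
    Homotopic G H :=
  homotopic_of_embedding_aux f (Set.toFinite _) (compl_compl _).symm
    (contractible_inter_of_dominated f h)

/-- If every vertex outside a contractible induced subgraph `H` of `G` is dominated by a vertex
of `H`, then `G` is contractible. -/
theorem contractible_of_dominated [Finite V]
    (h : ∀ v ∉ Set.range f, ∃ a, G.Adj v (f a) ∧ ∀ z, G.Adj v z → z ≠ f a → G.Adj (f a) z)
    (hH : Contractible H) : Contractible G :=
  contractible_of_embedding_aux f (Set.toFinite _) (compl_compl _).symm
    (contractible_inter_of_dominated f h) hH

/-- If the vertices outside an induced subgraph `H` of `G` are independent and have contractible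
unit spheres, then `G` is homotopic to `H`. -/
theorem homotopic_of_independent [Finite V]
    (hi : ∀ v ∉ Set.range f, ∀ z ∉ Set.range f, ¬ G.Adj v z)
    (h : ∀ v ∉ Set.range f, Contractible (unitSphere G v)) : Homotopic G H := by
  refine homotopic_of_embedding_aux f (Set.toFinite _) (compl_compl _).symm fun v hv r hr => ?_
  convert h v hv using 2
  all_goals
    refine Set.inter_eq_left.2 fun z hz hzr => hi v hv z (hr hzr) hz

end Embeddings

/-! ### Attached vertices: changing and splitting their links -/

/-- The graph obtained from `D` by adding pairwise non-adjacent new vertices `j : J`, where `j` is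
connected to the vertices in `ℓ j`. -/
def attach {V J : Type*} (D : SimpleGraph V) (ℓ : J → Set V) : SimpleGraph (V ⊕ J) where
  Adj
    | .inl a, .inl b => D.Adj a b
    | .inl a, .inr j => a ∈ ℓ j
    | .inr j, .inl a => a ∈ ℓ j
    | .inr _, .inr _ => False
  symm := ⟨by
    rintro (a | i) (b | j) h
    exacts [D.adj_symm h, h, h, h]⟩
  loopless := ⟨by
    rintro (a | i) h
    exacts [D.irrefl h, h]⟩

/-- The cone over a graph, with apex `none`. -/
def cone {V : Type*} (D : SimpleGraph V) : SimpleGraph (Option V) where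
  Adj
    | none, none => False
    | none, some _ => True
    | some _, none => True
    | some a, some b => D.Adj a b
  symm := ⟨by
    rintro (_ | a) (_ | b) h
    exacts [h, h, h, D.adj_symm h]⟩
  loopless := ⟨by
    rintro (_ | a) h
    exacts [h, D.irrefl h]⟩

section Adjacency
variable {V J : Type*} {D : SimpleGraph V} {ℓ : J → Set V} {a b : V} {i j : J}

@[simp] theorem attach_adj_inl_inl : (attach D ℓ).Adj (.inl a) (.inl b) ↔ D.Adj a b := Iff.rfl
@[simp] theorem attach_adj_inl_inr : (attach D ℓ).Adj (.inl a) (.inr j) ↔ a ∈ ℓ j := Iff.rfl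
@[simp] theorem attach_adj_inr_inl : (attach D ℓ).Adj (.inr j) (.inl a) ↔ a ∈ ℓ j := Iff.rfl
@[simp] theorem attach_adj_inr_inr : ¬ (attach D ℓ).Adj (.inr i) (.inr j) := id
@[simp] theorem cone_adj_none_none : ¬ (cone D).Adj none none := id
@[simp] theorem cone_adj_none_some : (cone D).Adj none (some a) := trivial
@[simp] theorem cone_adj_some_none : (cone D).Adj (some a) none := trivial
@[simp] theorem cone_adj_some_some : (cone D).Adj (some a) (some b) ↔ D.Adj a b := Iff.rfl

theorem cone_adj_none {x : Option V} (h : x ≠ none) : (cone D).Adj none x := by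
  cases x with
  | none => exact absurd rfl h
  | some a => trivial

end Adjacency

/-- The inclusion of `D` into `attach D ℓ`. -/
def attachInl {V J : Type*} (D : SimpleGraph V) (ℓ : J → Set V) : D ↪g attach D ℓ where
  toFun := .inl
  inj' := Sum.inl_injective
  map_rel_iff' := Iff.rfl

@[simp] theorem attachInl_apply {V J : Type*} (D : SimpleGraph V) (ℓ : J → Set V) (a : V) :
    attachInl D ℓ a = .inl a := rfl

theorem homotopic_attach {V J : Type u} [Finite V] [Finite J] {D : SimpleGraph V}
    {ℓ : J → Set V} (h : ∀ j, Contractible (D.induce (ℓ j))) : Homotopic (attach D ℓ) D := by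
  refine homotopic_of_independent (attachInl D ℓ) ?_ ?_
  · rintro (a | i) hi (b | j) hj
    exacts [(hi ⟨a, rfl⟩).elim, (hi ⟨a, rfl⟩).elim, (hj ⟨b, rfl⟩).elim, id]
  · rintro (a | j) hj
    · exact (hj ⟨a, rfl⟩).elim
    · refine (h j).of_iso
        (isoInduceOfRange ((Embedding.induce _).trans (attachInl D ℓ)) ?_)
      ext (a | i)
      · constructor
        · rintro ⟨⟨b, hb⟩, h⟩
          cases h
          exact hb
        · exact fun ha => ⟨⟨a, ha⟩, rfl⟩
      · simp

/-- The new vertices of `attach D ℓ` may be connected to larger sets `ℓ' j`, provided that the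
subgraph induced on `ℓ' j` and `j` is contractible. -/
theorem homotopic_relink {V J : Type u} [Finite V] [Finite J] {D : SimpleGraph V}
    {ℓ ℓ' : J → Set V} (hℓ : ∀ j, ℓ j ⊆ ℓ' j)
    (h : ∀ j, Contractible ((attach D ℓ).induce (insert (.inr j) (Sum.inl '' ℓ' j)))) :
    Homotopic (attach D ℓ) (attach D ℓ') := by
  -- A second vertex is attached to `j` and `ℓ' j` together. It dominates the old `j`, whose
  -- deletion leaves a vertex with link `ℓ' j`.
  refine .trans (.symm (homotopic_attach h)) ?_
  let f : attach D ℓ' ↪g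
      attach (attach D ℓ) (fun j => (insert (.inr j) (Sum.inl '' ℓ' j) : Set (V ⊕ J))) :=
    { toFun := Sum.map .inl id
      inj' := Sum.map_injective.2 ⟨Sum.inl_injective, Function.injective_id⟩
      map_rel_iff' := by rintro (a | i) (b | j) <;> simp }
  refine homotopic_of_dominated f ?_
  rintro ((a | j) | j) hj
  · exact (hj ⟨.inl a, rfl⟩).elim
  · refine ⟨.inr j, by simp [f], ?_⟩
    rintro ((a | i) | i) hz hne
    · exact Or.inr ⟨a, hℓ j hz, rfl⟩
    · exact hz.elim
    · simp [f] at hz hne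
      exact absurd hz.symm hne
  · exact (hj ⟨.inr j, rfl⟩).elim

/-- A version of `homotopic_relink` in which every vertex of `ℓ' j` outside `ℓ j` is dominated by
a vertex of `ℓ j`. -/
theorem homotopic_relink_of_dominated {V J : Type u} [Finite V] [Finite J] {D : SimpleGraph V}
    {ℓ ℓ' : J → Set V} (hℓ : ∀ j, ℓ j ⊆ ℓ' j)
    (h : ∀ j, ∀ v ∈ ℓ' j, v ∉ ℓ j → ∃ a ∈ ℓ j, D.Adj v a ∧
      ∀ z ∈ ℓ' j, D.Adj v z → z ≠ a → D.Adj a z) :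
    Homotopic (attach D ℓ) (attach D ℓ') := by
  refine homotopic_relink hℓ fun j => ?_
  refine contractible_of_dominated (induceInduce (attach D ℓ) (Set.insert_subset_insert
    (Set.image_mono (hℓ j)) : insert (.inr j) (Sum.inl '' ℓ j) ⊆ _)) ?_ ?_
  · rintro ⟨x, hx⟩ hv
    rw [range_induceInduce, Set.mem_preimage] at hv
    obtain rfl | ⟨v, hv', rfl⟩ := hx
    · exact (hv (.inl rfl)).elim
    · have hvℓ : v ∉ ℓ j := fun h => hv (.inr ⟨v, h, rfl⟩)
      obtain ⟨a, ha, hva, H⟩ := h j v hv' hvℓ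
      refine ⟨⟨.inl a, .inr ⟨a, ha, rfl⟩⟩, hva, ?_⟩
      rintro ⟨z, rfl | ⟨z, hz, rfl⟩⟩ hvz hne
      · exact ha
      · exact H z hz hvz fun h => hne (by subst h; rfl)
  · refine .induce_of_apex (a := .inr j) (.inl rfl) ?_
    rintro _ (rfl | ⟨z, hz, rfl⟩) hne
    · exact (hne rfl).elim
    · exact hz

/-- Splitting of attached vertices: if `ℓ j` is the union of `ℓ₁ j` and `ℓ₂ j` with contractible
intersection and without edges between the differences, then the vertex `j` may be replaced by two
vertices which are connected to `ℓ₁ j` and to `ℓ₂ j`. -/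
theorem homotopic_split {V J : Type u} [Finite V] [Finite J] {D : SimpleGraph V}
    {ℓ₁ ℓ₂ : J → Set V} (h : ∀ j, Contractible (D.induce (ℓ₁ j ∩ ℓ₂ j)))
    (hd : ∀ j, ∀ a ∈ ℓ₁ j, a ∉ ℓ₂ j → ∀ b ∈ ℓ₂ j, b ∉ ℓ₁ j → ¬ D.Adj a b) :
    Homotopic (attach D fun j => ℓ₁ j ∪ ℓ₂ j) (attach D (Sum.elim ℓ₁ ℓ₂)) := by
  -- The vertices with link `ℓ₂ j` belong to `E`. Those with link `ℓ₁ j` are relinked to `ℓ₁ j ∪ ℓ₂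
  -- j` and the old vertex `j`, which they then dominate.
  let E := attach D ℓ₂
  have e₁ : Homotopic (attach E fun j => Sum.inl '' ℓ₁ j) (attach D (Sum.elim ℓ₁ ℓ₂)) := by
    refine .iso ⟨(Equiv.sumAssoc V J J).trans ((Equiv.refl V).sumCongr (Equiv.sumComm J J)), ?_⟩
    rintro ((a | i) | i) ((b | j) | j) <;> simp [E]
  refine .trans (.trans ?_ (.symm (homotopic_relink (D := E)
    (ℓ' := fun j => insert (.inr j) (Sum.inl '' (ℓ₁ j ∪ ℓ₂ j))) ?_ ?_))) e₁
  · let f : attach D (fun j => ℓ₁ j ∪ ℓ₂ j) ↪g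
        attach E (fun j => (insert (.inr j) (Sum.inl '' (ℓ₁ j ∪ ℓ₂ j)) : Set (V ⊕ J))) :=
      { toFun := Sum.map .inl id
        inj' := Sum.map_injective.2 ⟨Sum.inl_injective, Function.injective_id⟩
        map_rel_iff' := by rintro (a | i) (b | j) <;> simp [E] }
    refine .symm (homotopic_of_dominated f ?_)
    rintro ((a | j) | j) hj
    · exact (hj ⟨.inl a, rfl⟩).elim
    · refine ⟨.inr j, by simp [f], ?_⟩
      rintro ((a | i) | i) hz hne
      · exact Or.inr ⟨a, .inr hz, rfl⟩
      · exact hz.elim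
      · simp [f] at hz hne
        exact absurd hz.symm hne
    · exact (hj ⟨.inr j, rfl⟩).elim
  · exact fun j => (Set.image_mono Set.subset_union_left).trans (Set.subset_insert _ _)
  · intro j
    let F := attach E fun j => Sum.inl '' ℓ₁ j
    let s : Set ((V ⊕ J) ⊕ J) :=
      insert (.inr j) (Sum.inl '' insert (.inr j) (Sum.inl '' (ℓ₁ j ∪ ℓ₂ j)))
    let t : Set ((V ⊕ J) ⊕ J) := (fun a => .inl (.inl a)) '' (ℓ₂ j \ ℓ₁ j)
    change Contractible (F.induce s)
    have hx : (.inl (.inr j) : (V ⊕ J) ⊕ J) ∈ s := .inr ⟨_, .inl rfl, rfl⟩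
    refine .of_induce_diff (t := t) (Set.toFinite _) ?_ ?_
    · rintro _ ⟨a, ha, rfl⟩ r hr
      -- By `hd`, a vertex of `ℓ₂ j \ ℓ₁ j` has all its other neighbours inside `s` in `ℓ₂ j`, so
      -- the old vertex `j` dominates it.
      refine .induce_of_apex (a := .inl (.inr j)) ⟨ha.1, hx, fun h => ?_⟩ ?_
      · obtain ⟨b, -, hb⟩ := hr h
        simp at hb
      · rintro _ ⟨hab, rfl | ⟨_, rfl | ⟨b, hb, rfl⟩, rfl⟩, hbr⟩ hne
        · obtain ⟨c, hc, h⟩ := hab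
          cases h
          exact (ha.2 hc).elim
        · exact (hne rfl).elim
        · change b ∈ ℓ₂ j
          by_contra hb₂
          exact hd j b (hb.resolve_right hb₂) hb₂ a ha.1 ha.2 (D.adj_symm hab)
    -- The unit sphere of the old `j` is now `ℓ₁ j ∩ ℓ₂ j`; without it the new `j` is an apex.
    · refine .induce_step (x := .inl (.inr j)) ⟨hx, by simp [t]⟩ ((h j).of_iso ?_) ?_
      · refine isoInduceOfRange (((Embedding.induce _).trans (attachInl D ℓ₂)).trans
          (attachInl E _)) ?_
        ext ((a | i) | i)
        · simp [s, t, F, E]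
          tauto
        · simp [F, E]
        · simp [F]
      · refine .induce_of_apex (a := .inr j) ⟨⟨.inl rfl, by simp [t]⟩, by simp⟩ ?_
        rintro _ ⟨⟨rfl | ⟨_, rfl | ⟨b, hb, rfl⟩, rfl⟩, hbt⟩, hne'⟩ hne
        · exact (hne rfl).elim
        · exact (hne' rfl).elim
        · refine ⟨b, ?_, rfl⟩
          by_contra hb₁
          exact hbt ⟨b, ⟨hb.resolve_left hb₁, hb₁⟩, rfl⟩

/-! ### Wedges of suspensions -/

/-- The disjoint union of copies of `L` indexed by `J`. -/
def copies {S : Type*} (J : Type*) (L : SimpleGraph S) : SimpleGraph (J × S) where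
  Adj x y := x.1 = y.1 ∧ L.Adj x.2 y.2
  symm := ⟨fun _ _ h => ⟨h.1.symm, h.2.symm⟩⟩
  loopless := ⟨fun _ h => L.irrefl h.2⟩

/-- The wedge sum of copies of the suspension of `L` indexed by `J`, glued at one of the poles. -/
def wedgeSusp {S : Type*} (J : Type*) (L : SimpleGraph S) : SimpleGraph (Option (J × S) ⊕ J) :=
  attach (cone (copies J L)) fun j => {x | ∃ s, x = some (j, s)}

/-- The disjoint union of `D` and of copies of `L`, where the copy `(j, s)` of a vertex of `L` is
connected to the closed neighbourhood of `φ j s` in the image of `φ j`. -/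
def prism {V J S : Type*} (D : SimpleGraph V) (L : SimpleGraph S) (φ : J → L ↪g D) :
    SimpleGraph (V ⊕ J × S) where
  Adj
    | .inl a, .inl b => D.Adj a b
    | .inl a, .inr x => ∃ t, φ x.1 t = a ∧ (t = x.2 ∨ L.Adj t x.2)
    | .inr x, .inl a => ∃ t, φ x.1 t = a ∧ (t = x.2 ∨ L.Adj t x.2)
    | .inr x, .inr y => x.1 = y.1 ∧ L.Adj x.2 y.2
  symm := ⟨by
    rintro (a | x) (b | y) h
    exacts [D.adj_symm h, h, h, ⟨h.1.symm, h.2.symm⟩]⟩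
  loopless := ⟨by
    rintro (a | x) h
    exacts [D.irrefl h, L.irrefl h.2]⟩

/-- The inclusion of a graph into the cone over it. -/
def coneSome {V : Type*} (D : SimpleGraph V) : D ↪g cone D where
  toFun := some
  inj' := Option.some_injective _
  map_rel_iff' := Iff.rfl

@[simp] theorem coneSome_apply {V : Type*} (D : SimpleGraph V) (a : V) : coneSome D a = some a :=
  rfl

/-- The apex is in no link, so its unit sphere is `D`, which is contractible. -/
theorem attach_cone_homotopic {V J : Type u} [Finite V] [Finite J] {D : SimpleGraph V}
    (hD : Contractible D) (ℓ : J → Set V) :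
    Homotopic (attach (cone D) fun j => some '' ℓ j) (attach D ℓ) := by
  let f : attach D ℓ ↪g attach (cone D) fun j => some '' ℓ j :=
    { toFun := Sum.map some id
      inj' := Sum.map_injective.2 ⟨Option.some_injective _, Function.injective_id⟩
      map_rel_iff' := by rintro (a | i) (b | j) <;> simp }
  refine homotopic_of_independent f ?_ ?_
  · rintro ((_ | a) | i) hi ((_ | b) | j) hj
    any_goals exact (hi ⟨.inl _, rfl⟩).elim
    any_goals exact (hi ⟨.inr _, rfl⟩).elim
    any_goals exact (hj ⟨.inl _, rfl⟩).elim
    any_goals exact (hj ⟨.inr _, rfl⟩).elim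
    exact id
  · rintro ((_ | a) | i) hi
    · refine hD.of_iso (isoInduceOfRange ((coneSome D).trans (attachInl _ _)) ?_)
      ext ((_ | b) | j) <;> simp
    · exact (hi ⟨.inl a, rfl⟩).elim
    · exact (hi ⟨.inr i, rfl⟩).elim

/-- A graph obtained from a contractible graph by attaching pairwise non-adjacent vertices with
unit spheres isomorphic to `L` is homotopic to a wedge sum of suspensions of `L`. -/
theorem attach_homotopic_wedgeSusp {V J S : Type u} [Finite V] [Finite J] [Finite S]
    {D : SimpleGraph V} (hD : Contractible D) {L : SimpleGraph S} (φ : J → L ↪g D) :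
    Homotopic (attach D fun j => Set.range (φ j)) (wedgeSusp J L) := by
  -- Each prism is a cylinder joining `φ j (L)` to a private copy of `L`. Links slide along it from
  -- `ℓ₁` through `ℓ₁ ∪ ℓ₂` to `ℓ₂`; corresponding vertices at the two ends dominate each other
  -- there.
  let E := cone (prism D L φ)
  let ℓ₁ : J → Set (Option (V ⊕ J × S)) := fun j => {x | ∃ s, x = some (.inl (φ j s))}
  let ℓ₂ : J → Set (Option (V ⊕ J × S)) := fun j => {x | ∃ s, x = some (.inr (j, s))}
  have h₁ : Homotopic (attach E ℓ₁) (attach E fun j => ℓ₁ j ∪ ℓ₂ j) := by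
    refine homotopic_relink_of_dominated (fun _ => Set.subset_union_left) ?_
    rintro j _ (⟨s, rfl⟩ | ⟨s, rfl⟩) hs
    · exact (hs ⟨s, rfl⟩).elim
    · refine ⟨_, ⟨s, rfl⟩, ⟨s, rfl, .inl rfl⟩, ?_⟩
      rintro _ (⟨t, rfl⟩ | ⟨t, rfl⟩) h hne
      · obtain ⟨t', ht', rfl | h⟩ := h
        · obtain rfl := (φ j).injective ht'
          exact (hne rfl).elim
        · obtain rfl := (φ j).injective ht'
          exact (φ j).map_adj_iff.2 h.symm
      · exact ⟨s, rfl, .inr h.2⟩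
  have h₂ : Homotopic (attach E ℓ₂) (attach E fun j => ℓ₁ j ∪ ℓ₂ j) := by
    refine homotopic_relink_of_dominated (fun _ => Set.subset_union_right) ?_
    rintro j _ (⟨s, rfl⟩ | ⟨s, rfl⟩) hs
    · refine ⟨_, ⟨s, rfl⟩, ⟨s, rfl, .inl rfl⟩, ?_⟩
      rintro _ (⟨t, rfl⟩ | ⟨t, rfl⟩) h hne
      · exact ⟨t, rfl, .inr ((φ j).map_adj_iff.1 h).symm⟩
      · obtain ⟨t', ht', rfl | h⟩ := h
        · obtain rfl := (φ j).injective ht'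
          exact (hne rfl).elim
        · obtain rfl := (φ j).injective ht'
          exact ⟨rfl, h⟩
    · exact (hs ⟨s, rfl⟩).elim
  -- Vertices outside all links are dominated by the cone apex: here the private copies, in `h₄` the
  -- vertices of `D`.
  have h₃ : Homotopic (attach E ℓ₁)
      (attach (cone D) fun j => some '' Set.range (φ j)) := by
    refine homotopic_of_dominated
      { toFun := Sum.map (Option.map .inl) id
        inj' := Sum.map_injective.2
          ⟨Option.map_injective Sum.inl_injective, Function.injective_id⟩
        map_rel_iff' := ?_ } ?_
    · rintro ((_ | a) | i) ((_ | b) | j) <;> simp [E, ℓ₁, prism, cone, eq_comm]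
    · rintro ((_ | a | x) | i) hi
      · exact (hi ⟨.inl none, rfl⟩).elim
      · exact (hi ⟨.inl (some a), rfl⟩).elim
      · refine ⟨.inl none, trivial, ?_⟩
        rintro ((_ | z) | j) hz hne
        · exact (hne rfl).elim
        · trivial
        · obtain ⟨s, hs⟩ := hz
          simp at hs
      · exact (hi ⟨.inr i, rfl⟩).elim
  have h₄ : Homotopic (attach E ℓ₂) (wedgeSusp J L) := by
    refine homotopic_of_dominated
      { toFun := Sum.map (Option.map .inr) id
        inj' := Sum.map_injective.2
          ⟨Option.map_injective Sum.inr_injective, Function.injective_id⟩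
        map_rel_iff' := ?_ } ?_
    · rintro ((_ | a) | i) ((_ | b) | j) <;> simp [E, ℓ₂, prism, cone, wedgeSusp, copies]
    · rintro ((_ | a | x) | i) hi
      · exact (hi ⟨.inl none, rfl⟩).elim
      · refine ⟨.inl none, trivial, ?_⟩
        rintro ((_ | z) | j) hz hne
        · exact (hne rfl).elim
        · trivial
        · obtain ⟨s, hs⟩ := hz
          simp at hs
      · exact (hi ⟨.inl (some x), rfl⟩).elim
      · exact (hi ⟨.inr i, rfl⟩).elim
  exact (attach_cone_homotopic hD _).symm.trans
    (h₃.symm.trans (h₁.trans (h₂.symm.trans h₄)))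

/-! ### Joins and their homotopy invariance -/

/-- The Zykov join of two graphs. -/
def join {V W : Type*} (A : SimpleGraph V) (B : SimpleGraph W) : SimpleGraph (V ⊕ W) where
  Adj
    | .inl a, .inl b => A.Adj a b
    | .inl _, .inr _ => True
    | .inr _, .inl _ => True
    | .inr a, .inr b => B.Adj a b
  symm := ⟨by
    rintro (a | a) (b | b) h
    exacts [A.adj_symm h, h, h, B.adj_symm h]⟩
  loopless := ⟨by
    rintro (a | a) h
    exacts [A.irrefl h, B.irrefl h]⟩

section Adjacency
variable {V W : Type*} {A : SimpleGraph V} {B : SimpleGraph W} {a b : V} {c d : W}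

@[simp] theorem join_adj_inl_inl : (join A B).Adj (.inl a) (.inl b) ↔ A.Adj a b := Iff.rfl
@[simp] theorem join_adj_inl_inr : (join A B).Adj (.inl a) (.inr c) := trivial
@[simp] theorem join_adj_inr_inl : (join A B).Adj (.inr c) (.inl a) := trivial
@[simp] theorem join_adj_inr_inr : (join A B).Adj (.inr c) (.inr d) ↔ B.Adj c d := Iff.rfl

end Adjacency

/-- The join of two graph embeddings. -/
def joinEmbedding {V W V' W' : Type*} {A : SimpleGraph V} {B : SimpleGraph W}
    {A' : SimpleGraph V'} {B' : SimpleGraph W'} (f : A ↪g A') (g : B ↪g B') :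
    join A B ↪g join A' B' where
  toFun := Sum.map f g
  inj' := Sum.map_injective.2 ⟨f.injective, g.injective⟩
  map_rel_iff' := by rintro (a | a) (b | b) <;> simp

@[simp] theorem joinEmbedding_inl {V W V' W' : Type*} {A : SimpleGraph V} {B : SimpleGraph W}
    {A' : SimpleGraph V'} {B' : SimpleGraph W'} (f : A ↪g A') (g : B ↪g B') (a : V) :
    joinEmbedding f g (.inl a) = .inl (f a) := rfl

@[simp] theorem joinEmbedding_inr {V W V' W' : Type*} {A : SimpleGraph V} {B : SimpleGraph W}
    {A' : SimpleGraph V'} {B' : SimpleGraph W'} (f : A ↪g A') (g : B ↪g B') (a : W) :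
    joinEmbedding f g (.inr a) = .inr (g a) := rfl

/-- The join of two graph isomorphisms. -/
def joinCongr {V W V' W' : Type*} {A : SimpleGraph V} {B : SimpleGraph W}
    {A' : SimpleGraph V'} {B' : SimpleGraph W'} (f : A ≃g A') (g : B ≃g B') :
    join A B ≃g join A' B' where
  toEquiv := f.toEquiv.sumCongr g.toEquiv
  map_rel_iff' := by
    rintro (a | a) (b | b)
    exacts [f.map_adj_iff, Iff.rfl, Iff.rfl, g.map_adj_iff]

/-- Commutativity of the join. -/
def joinComm {V W : Type*} (A : SimpleGraph V) (B : SimpleGraph W) : join A B ≃g join B A where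
  toEquiv := Equiv.sumComm V W
  map_rel_iff' := by rintro (a | a) (b | b) <;> simp

/-- Associativity of the join. -/
def joinAssoc {U V W : Type*} (A : SimpleGraph U) (B : SimpleGraph V) (C : SimpleGraph W) :
    join (join A B) C ≃g join A (join B C) where
  toEquiv := Equiv.sumAssoc U V W
  map_rel_iff' := by rintro ((a | a) | a) ((b | b) | b) <;> simp

/-- The join with a graph without vertices. -/
def joinEmpty {V W : Type*} [IsEmpty V] (A : SimpleGraph V) (B : SimpleGraph W) :
    join A B ≃g B where
  toEquiv := Equiv.emptySum V W
  map_rel_iff' := by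
    rintro (a | a) (b | b)
    exacts [isEmptyElim a, isEmptyElim a, isEmptyElim b, Iff.rfl]

/-- The unit sphere of a join at a vertex of the first graph. -/
noncomputable def unitSphereJoin {V W : Type*} (A : SimpleGraph V) (B : SimpleGraph W) (x : V) :
    join (unitSphere A x) B ≃g unitSphere (join A B) (.inl x) :=
  isoInduceOfRange (joinEmbedding (Embedding.induce _) Embedding.refl) (by
    ext (a | a)
    · simp
    · simp)

/-- Deleting a vertex of the first graph from a join. -/
noncomputable def deleteVertexJoin {V W : Type*} (A : SimpleGraph V) (B : SimpleGraph W) (x : V) :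
    join (deleteVertex A x) B ≃g deleteVertex (join A B) (.inl x) :=
  isoInduceOfRange (joinEmbedding (Embedding.induce _) Embedding.refl) (by
    ext (a | a)
    · simp
    · simp)

/-- Unit spheres and deletions at vertices of `A` are again joins with `B`, so the dismantling of
`A` carries over; when `A` is a point the join is a cone. -/
theorem Contractible.join {V W : Type u} {A : SimpleGraph V} (hA : Contractible A)
    [Finite W] (B : SimpleGraph W) : Contractible (join A B) := by
  induction hA with
  | @point V A x hx =>
    have : Subsingleton V := ⟨fun a b => (hx a).trans (hx b).symm⟩
    have : Finite V := inferInstance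
    refine .of_apex (.inl x) ?_
    rintro (b | b) hb
    · exact (hb (congrArg _ (hx b))).elim
    · trivial
  | step A x _ _ ihS ihD =>
    exact .step _ (.inl x) (ihS.of_iso (unitSphereJoin A B x)) (ihD.of_iso (deleteVertexJoin A B x))

theorem Homotopic.join_right {V V' W : Type u} {A : SimpleGraph V} {A' : SimpleGraph V'}
    (h : Homotopic A A') [Finite W] (B : SimpleGraph W) : Homotopic (join A B) (join A' B) := by
  induction h with
  | iso e => exact .iso (joinCongr e .refl)
  | reduction G x hS =>
    exact .trans (.reduction _ (.inl x) ((hS.join B).of_iso (unitSphereJoin G B x)))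
      (.symm (.iso (deleteVertexJoin G B x)))
  | symm _ ih => exact ih.symm
  | trans _ _ ih₁ ih₂ => exact ih₁.trans ih₂

theorem Homotopic.join_left {V V' W : Type u} {A : SimpleGraph V} {A' : SimpleGraph V'}
    (h : Homotopic A A') [Finite W] (B : SimpleGraph W) : Homotopic (join B A) (join B A') :=
  .trans (.iso (joinComm _ _)) (.trans (h.join_right B) (.iso (joinComm _ _)))

/-! ### Joins with wedges of suspensions -/

/-- The inclusion of a summand into a disjoint union of copies of a graph. -/
def copiesMk {S J : Type*} (L : SimpleGraph S) (j : J) : L ↪g copies J L where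
  toFun s := (j, s)
  inj' := Prod.mk_right_injective j
  map_rel_iff' := by simp [copies]

@[simp] theorem copiesMk_apply {S J : Type*} (L : SimpleGraph S) (j : J) (s : S) :
    copiesMk L j s = (j, s) := rfl

theorem contractible_join_cone {V W : Type u} [Finite V] [Finite W] (A : SimpleGraph V)
    (B : SimpleGraph W) : Contractible (join A (cone B)) := by
  refine .of_apex (.inr none) ?_
  rintro (b | b) hb
  · trivial
  · exact cone_adj_none fun h => hb (congrArg _ h)

/-- The embedding of the join with a suspended graph. -/
def joinCopiesEmbedding {S K K' J : Type*} {A : SimpleGraph K} {A' : SimpleGraph K'}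
    (f : A ↪g A') (L : SimpleGraph S) (j : J) : join A L ↪g join A' (cone (copies J L)) :=
  joinEmbedding f ((copiesMk L j).trans (coneSome _))

/-- The join of a graph with a wedge of suspensions, as a graph with attached vertices. -/
def joinWedgeSusp {K S : Type*} (A : SimpleGraph K) (J : Type*) (L : SimpleGraph S) :
    join A (wedgeSusp J L) ≃g attach (join A (cone (copies J L)))
      fun j => Set.range (joinCopiesEmbedding (Embedding.refl (G := A)) L j) where
  toEquiv := (Equiv.sumAssoc _ _ _).symm
  map_rel_iff' := by
    rintro (a | a | a) (b | b | b) <;> simp [joinCopiesEmbedding, wedgeSusp, eq_comm]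

/-- The cone apex makes the join of `A` with the base contractible, and each attached vertex now has
link `join A L`. -/
theorem join_wedgeSusp_homotopic {K S J : Type u} [Finite K] [Finite S] [Finite J]
    (A : SimpleGraph K) (L : SimpleGraph S) :
    Homotopic (join A (wedgeSusp J L)) (wedgeSusp J (join A L)) :=
  .trans (.iso (joinWedgeSusp A J L))
    (attach_homotopic_wedgeSusp (contractible_join_cone _ _) _)

/-- The join with three isolated vertices. -/
theorem join_bot_three_wedgeSusp_homotopic {S J : Type} [Finite S] [Finite J]
    (L : SimpleGraph S) :
    Homotopic (join (⊥ : SimpleGraph (Fin 3)) (wedgeSusp J L))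
      (wedgeSusp (J ⊕ J) (join (⊥ : SimpleGraph (Fin 2)) L)) := by
  let D := join (⊥ : SimpleGraph (Fin 3)) (cone (copies J L))
  let f (i : Fin 3) (hi : i ≠ 0) : (⊥ : SimpleGraph (Fin 2)) ↪g (⊥ : SimpleGraph (Fin 3)) :=
    { toFun := ![0, i]
      inj' := by
        intro a b h
        fin_cases a <;> fin_cases b <;> simp_all [eq_comm]
      map_rel_iff' := by simp }
  let φ (i : Fin 3) (hi : i ≠ 0) (j : J) : join (⊥ : SimpleGraph (Fin 2)) L ↪g D :=
    joinCopiesEmbedding (f i hi) L j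
  have h1 : (1 : Fin 3) ≠ 0 := by decide
  have h2 : (2 : Fin 3) ≠ 0 := by decide
  have hφ (i hi j) (x) : x ∈ Set.range (φ i hi j) ↔
      x = .inl 0 ∨ x = .inl i ∨ ∃ s, x = .inr (some (j, s)) := by
    simp [φ, joinCopiesEmbedding, f, Fin.exists_fin_two, eq_comm, or_assoc]
    rfl
  have hψ (j : J) (x) : x ∈ Set.range
      (joinCopiesEmbedding (Embedding.refl (G := (⊥ : SimpleGraph (Fin 3)))) L j) ↔
      x = .inl 0 ∨ x = .inl 1 ∨ x = .inl 2 ∨ ∃ s, x = .inr (some (j, s)) := by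
    simp [joinCopiesEmbedding, Fin.exists_fin_succ, eq_comm, or_assoc]
  -- The link, three points joined with `L`, is the union of the suspensions with poles 0, 1 and 0,
  -- 2. They meet in a cone with apex 0, and the remaining poles 1 and 2 are not adjacent. Splitting
  -- turns `J` into `J ⊕ J`.
  have hs : Homotopic (attach D fun j => Set.range (φ 1 h1 j) ∪ Set.range (φ 2 h2 j))
      (attach D (Sum.elim (fun j => Set.range (φ 1 h1 j)) fun j => Set.range (φ 2 h2 j))) := by
    refine homotopic_split ?_ ?_
    · intro j
      refine .induce_of_apex (a := .inl 0) ?_ ?_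
      · simp [hφ]
      · intro b hb hne
        rw [Set.mem_inter_iff, hφ 1 h1, hφ 2 h2] at hb
        obtain ⟨h | rfl | ⟨s, rfl⟩, h' | h' | ⟨s', h'⟩⟩ := hb <;> simp_all [D]
    · intro j a ha ha' b hb hb' hab
      rw [hφ 1 h1] at ha hb'
      rw [hφ 2 h2] at ha' hb
      obtain rfl : a = .inl 1 := by tauto
      obtain rfl : b = .inl 2 := by tauto
      exact hab
  have := attach_homotopic_wedgeSusp (D := D) (contractible_join_cone _ _)
      (Sum.elim (φ 1 h1) (φ 2 h2))
  refine .trans (.iso (joinWedgeSusp _ J L)) (.trans ?_ (hs.trans ?_))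
  · convert Homotopic.refl _ using 3 with j
    ext x
    rw [Set.mem_union, hφ 1 h1, hφ 2 h2, hψ]
    tauto
  · convert this using 2
    ext (j | j) x <;> rfl

section Adjacency
variable {S J : Type*} {L : SimpleGraph S} {x y : J × S} {i j : J} {u v : Option (J × S)}

@[simp] theorem wedgeSusp_adj_inl_inl :
    (wedgeSusp J L).Adj (.inl u) (.inl v) ↔ (cone (copies J L)).Adj u v := Iff.rfl
@[simp] theorem copies_adj : (copies J L).Adj x y ↔ x.1 = y.1 ∧ L.Adj x.2 y.2 := Iff.rfl
@[simp] theorem wedgeSusp_adj_none_inr : ¬ (wedgeSusp J L).Adj (.inl none) (.inr j) :=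
  fun ⟨_, h⟩ => by simp at h
@[simp] theorem wedgeSusp_adj_inr_none : ¬ (wedgeSusp J L).Adj (.inr j) (.inl none) :=
  fun ⟨_, h⟩ => by simp at h
@[simp] theorem wedgeSusp_adj_inl_inr :
    (wedgeSusp J L).Adj (.inl (some x)) (.inr j) ↔ x.1 = j :=
  ⟨fun ⟨_, h⟩ => by cases h; rfl, fun h => ⟨x.2, by rw [← h]⟩⟩
@[simp] theorem wedgeSusp_adj_inr_inl :
    (wedgeSusp J L).Adj (.inr j) (.inl (some x)) ↔ x.1 = j :=
  wedgeSusp_adj_inl_inr (L := L)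
@[simp] theorem wedgeSusp_adj_inr_inr : ¬ (wedgeSusp J L).Adj (.inr i) (.inr j) := id

end Adjacency

/-! ### Comparison with standard spheres and their wedges -/

/-- An isomorphism of wedges of suspensions. -/
def wedgeSuspCongr {S S' J J' : Type*} {L : SimpleGraph S} {L' : SimpleGraph S'} (e : J ≃ J')
    (f : L ≃g L') : wedgeSusp J L ≃g wedgeSusp J' L' where
  toEquiv := ((e.prodCongr f.toEquiv).optionCongr).sumCongr e
  map_rel_iff' := by
    have h : ∀ a b : S, L'.Adj (f a) (f b) ↔ L.Adj a b := fun _ _ => f.map_adj_iff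
    rintro ((_ | a) | i) ((_ | b) | j) <;> simp [h]

/-- The suspension of a cross-polytope graph. -/
def joinCompleteEquipartite (w : ℕ) :
    join (⊥ : SimpleGraph (Fin 2)) (completeEquipartiteGraph w 2) ≃g
      completeEquipartiteGraph (w + 1) 2 where
  toFun := Sum.elim (fun i => (0, i)) fun x => (x.1.succ, x.2)
  invFun x := Fin.cases (.inl x.2) (fun k => .inr (k, x.2)) x.1
  left_inv := by rintro (i | ⟨k, i⟩) <;> rfl
  right_inv := by
    rintro ⟨k, i⟩
    cases k using Fin.cases <;> rfl
  map_rel_iff' := by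
    rintro (i | ⟨k, i⟩) (j | ⟨l, j⟩) <;> simp [Fin.succ_ne_zero, eq_comm]

/-- The wedge of suspensions of cross-polytopes, as a wedge of spheres. -/
def wedgeSuspIsoWedgeOfSpheres (m d : ℕ) :
    wedgeSusp (Fin m) (completeEquipartiteGraph d 2) ≃g wedgeOfSpheres m d where
  toFun := Sum.elim (Option.map fun x => (x.1, ⟨(x.2.1.succ, x.2.2), by simp⟩))
    fun j => some (j, ⟨(0, 1), by simp⟩)
  invFun
    | none => .inl none
    | some (j, x) => Fin.cases (.inr j) (fun k => .inl (some (j, (k, x.1.2)))) x.1.1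
  left_inv := by rintro ((_ | ⟨j, k, i⟩) | j) <;> rfl
  right_inv := by
    rintro (_ | ⟨j, ⟨k, i⟩, h⟩)
    · rfl
    · cases k using Fin.cases with
      | zero =>
        fin_cases i
        · exact absurd rfl h
        · rfl
      | succ k => rfl
  map_rel_iff' := by
    rintro ((_ | ⟨j, k, i⟩) | j) ((_ | ⟨j', k', i'⟩) | j') <;>
      simp [wedgeCopies, Fin.succ_ne_zero, (Fin.succ_ne_zero _).symm, eq_comm]

/-- The suspension of a cross-polytope, as a sphere. -/
def wedgeSuspIsoSphere (J : Type*) [Unique J] (d : ℕ) :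
    wedgeSusp J (completeEquipartiteGraph d 2) ≃g sphere d where
  toFun := Sum.elim (fun x => x.elim (0, 0) fun x => (x.2.1.succ, x.2.2)) fun _ => (0, 1)
  invFun x := Fin.cases (if x.2 = 0 then .inl none else .inr default)
    (fun k => .inl (some (default, (k, x.2)))) x.1
  left_inv := by
    rintro ((_ | ⟨j, k, i⟩) | j)
    · rfl
    · simp [Subsingleton.elim j default]
    · simp [Subsingleton.elim j default]
  right_inv := by
    rintro ⟨k, i⟩
    cases k using Fin.cases with
    | zero => fin_cases i <;> rfl
    | succ k => rfl
  map_rel_iff' := by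
    rintro ((_ | ⟨j, k, i⟩) | j) ((_ | ⟨j', k', i'⟩) | j') <;>
      simp [Fin.succ_ne_zero, (Fin.succ_ne_zero _).symm, eq_iff_true_of_subsingleton]

/-- For empty `L` both graphs are edgeless, so equal cardinality suffices. This starts the
suspension induction at the empty graph. -/
theorem join_bot_empty_homotopic {K V J S : Type u} [Finite K] [Finite J] [IsEmpty V] [IsEmpty S]
    (G : SimpleGraph V) (L : SimpleGraph S) (h : Nat.card K = Nat.card J + 1) :
    Homotopic (join (⊥ : SimpleGraph K) G) (wedgeSusp J L) := by
  have e : Nonempty (K ⊕ V ≃ Option (J × S) ⊕ J) := by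
    refine Finite.card_eq.1 ?_
    rw [Nat.card_sum, Nat.card_sum, Finite.card_option]
    simp [h, add_comm]
  refine .iso ⟨e.some, ?_⟩
  rintro (a | a) (b | b)
  · generalize e.some (.inl a) = x
    generalize e.some (.inl b) = y
    rcases x with (_ | ⟨_, s⟩) | x
    rcases y with (_ | ⟨_, s⟩) | y
    · simp
    · exact isEmptyElim s
    · simp
    · exact isEmptyElim s
    rcases y with (_ | ⟨_, s⟩) | y
    · simp
    · exact isEmptyElim s
    · simp
  · exact isEmptyElim b
  · exact isEmptyElim a
  · exact isEmptyElim a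

/-! ### Bouquets of spheres under joins with two or three points -/

/-- A graph homotopic to a wedge sum of `2 ^ c` spheres of dimension `w - 1`; for `w = 0` the
empty graph, which is regarded as the `(-1)`-sphere. -/
def IsBouquet {V : Type} (c : ℕ) : ℕ → SimpleGraph V → Prop
  | 0, _ => c = 0 ∧ IsEmpty V
  | w + 1, G => Homotopic G (wedgeSusp (Fin (2 ^ c)) (completeEquipartiteGraph w 2))

namespace IsBouquet
variable {V W : Type} {c w : ℕ} {G : SimpleGraph V} {H : SimpleGraph W}

theorem of_homotopic (hH : IsBouquet c w H) (h : Homotopic G H) (hw : w ≠ 0) :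
    IsBouquet c w G := by
  cases w with
  | zero => exact (hw rfl).elim
  | succ w => exact h.trans hH

theorem of_iso (hH : IsBouquet c w H) (e : G ≃g H) : IsBouquet c w G := by
  cases w with
  | zero =>
    have := hH.2
    exact ⟨hH.1, e.toEquiv.isEmpty⟩
  | succ w => exact .trans (.iso e) hH

theorem join_two [Finite V] (h : IsBouquet c w G) :
    IsBouquet c (w + 1) (join (⊥ : SimpleGraph (Fin 2)) G) := by
  cases w with
  | zero =>
    obtain ⟨rfl, _⟩ := h
    exact join_bot_empty_homotopic _ _ (by simp)
  | succ w =>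
    exact .trans (.join_left h _) (.trans (join_wedgeSusp_homotopic _ _)
      (.iso (wedgeSuspCongr (.refl _) (joinCompleteEquipartite w))))

theorem join_three [Finite V] (h : IsBouquet c w G) :
    IsBouquet (c + 1) (w + 1) (join (⊥ : SimpleGraph (Fin 3)) G) := by
  cases w with
  | zero =>
    obtain ⟨rfl, _⟩ := h
    exact join_bot_empty_homotopic _ _ (by simp)
  | succ w =>
    exact .trans (.join_left h _) (.trans (join_bot_three_wedgeSusp_homotopic _)
      (.iso (wedgeSuspCongr (finSumFinEquiv.trans (finCongr (by ring)))
        (joinCompleteEquipartite w))))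

theorem homotopic_wedgeOfSpheres (h : IsBouquet c (w + 1) G) :
    Homotopic G (wedgeOfSpheres (2 ^ c) w) :=
  .trans h (.iso (wedgeSuspIsoWedgeOfSpheres _ _))

theorem homotopic_sphere (h : IsBouquet 0 (w + 1) G) : Homotopic G (sphere w) :=
  have : Unique (Fin (2 ^ 0)) := inferInstanceAs (Unique (Fin 1))
  .trans h (.iso (wedgeSuspIsoSphere _ _))

end IsBouquet

/-! ### Reducing path and cycle complements by three vertices -/

/-- A graph, as the graph without the vertex `a` with `a` attached. -/
noncomputable def attachIso {V : Type u} {G : SimpleGraph V} {a : V}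
    {D : SimpleGraph ({a}ᶜ : Set V)} {ℓ : Set ({a}ᶜ : Set V)}
    (hD : ∀ x y, D.Adj x y ↔ G.Adj x y) (hℓ : ∀ x, x ∈ ℓ ↔ G.Adj x a) :
    attach D (fun _ : PUnit.{u + 1} => ℓ) ≃g G where
  toEquiv := Equiv.ofBijective (Sum.elim Subtype.val fun _ => a) (by
    constructor
    · rintro (x | x) (y | y) h
      · exact congrArg _ (Subtype.ext h)
      · exact (x.2 h).elim
      · exact (y.2 h.symm).elim
      · rfl
    · intro x
      by_cases hx : x = a
      · exact ⟨.inr ⟨⟩, hx.symm⟩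
      · exact ⟨.inl ⟨x, hx⟩, rfl⟩)
  map_rel_iff' := by
    rintro (x | x) (y | y)
    · exact (hD x y).symm
    · exact (hℓ x).symm
    · exact (G.adj_comm _ _).trans (hℓ y).symm
    · exact iff_of_false G.irrefl id

/-- An edge `a b` may be added to a graph if the common neighbourhood of `a` and `b` is a cone. -/
theorem homotopic_of_add_edge {V : Type u} [Finite V] {G G' : SimpleGraph V} (a b q : V)
    (hle : ∀ x y, G.Adj x y → G'.Adj x y)
    (hG : ∀ x y, G'.Adj x y → G.Adj x y ∨ (x = a ∧ y = b) ∨ (x = b ∧ y = a))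
    (hq : G.Adj q a) (hqb : G.Adj q b)
    (h : ∀ z, G.Adj z a → G.Adj z b → z ≠ q → G.Adj q z) : Homotopic G G' := by
  -- The graphs differ at most in an edge at `a`, so both arise by attaching `a` to the same graph.
  -- Adding `b` to the link is allowed because `q` dominates `b` there.
  have e : ∀ x y : ({a}ᶜ : Set V), (deleteVertex G a).Adj x y ↔ G'.Adj x y := by
    rintro ⟨x, hx⟩ ⟨y, hy⟩
    refine ⟨hle x y, fun h => ?_⟩
    rcases hG x y h with h | h | h
    exacts [h, (hx h.1).elim, (hy h.2).elim]
  refine .trans (.symm (.iso (attachIso (D := deleteVertex G a) (ℓ := {x | G.Adj x a})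
    (fun _ _ => Iff.rfl) fun _ => Iff.rfl))) (.trans ?_ (.iso (attachIso
    (D := deleteVertex G a) (ℓ := {x | G'.Adj x a}) e fun _ => Iff.rfl)))
  refine homotopic_relink_of_dominated (fun _ x hx => hle _ _ hx) ?_
  rintro _ ⟨v, hv⟩ hva hva'
  obtain rfl : v = b := by
    rcases hG v a hva with h | h | h
    exacts [(hva' h).elim, (hv h.1).elim, h.1]
  refine ⟨⟨q, hq.ne⟩, hq, hqb.symm, ?_⟩
  rintro ⟨z, hz⟩ hza hvz hne
  refine h z ?_ hvz.symm fun h => hne (Subtype.ext h)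
  rcases hG z a hza with h | h | h
  exacts [h, (hz h.1).elim, (hvz.ne' (Subtype.ext h.1)).elim]

/-- Embedding of the suspension of a graph on `n` vertices as a graph on the vertices `0`, `1` and
`3, …, n + 2`. -/
def suspensionEmbedding {n : ℕ} {H : SimpleGraph (Fin n)} {G : SimpleGraph (Fin (n + 3))}
    (h₂ : ∀ i j : Fin (n + 3), i.val < 2 → j.val < 2 → ¬ G.Adj i j)
    (h₃ : ∀ i j : Fin (n + 3), i.val < 2 → 3 ≤ j.val → G.Adj i j)
    (h : ∀ i j : Fin n, G.Adj (i.addNat 3) (j.addNat 3) ↔ H.Adj i j) :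
    join (⊥ : SimpleGraph (Fin 2)) H ↪g G where
  toFun := Sum.elim (fun i => ⟨i, by omega⟩) fun i => i.addNat 3
  inj' := by
    rintro (i | i) (j | j) hij <;> replace hij := congrArg Fin.val hij
    · exact congrArg _ (Fin.ext hij)
    · change i.val = j.val + 3 at hij
      omega
    · change i.val + 3 = j.val at hij
      omega
    · change i.val + 3 = j.val + 3 at hij
      exact congrArg _ (Fin.ext (by omega))
  map_rel_iff' := by
    rintro (i | i) (j | j)
    · exact iff_of_false (h₂ _ _ i.2 j.2) id
    · exact iff_of_true (h₃ _ _ i.2 (Nat.le_add_left 3 _)) trivial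
    · exact iff_of_true (h₃ _ _ j.2 (Nat.le_add_left 3 _)).symm trivial
    · exact h i j

theorem eq_two_of_notMem_range {n : ℕ} {H : SimpleGraph (Fin n)} {G : SimpleGraph (Fin (n + 3))}
    {h₂ : ∀ i j : Fin (n + 3), i.val < 2 → j.val < 2 → ¬ G.Adj i j}
    {h₃ : ∀ i j : Fin (n + 3), i.val < 2 → 3 ≤ j.val → G.Adj i j}
    {h : ∀ i j : Fin n, G.Adj (i.addNat 3) (j.addNat 3) ↔ H.Adj i j} {v : Fin (n + 3)}
    (hv : v ∉ Set.range (suspensionEmbedding h₂ h₃ h)) : v = 2 := by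
  by_contra hne
  have hne' : v.val ≠ 2 := fun h => hne (Fin.ext h)
  rcases lt_or_ge v.val 2 with h | h
  · exact hv ⟨.inl ⟨v, h⟩, rfl⟩
  · refine hv ⟨.inr ⟨v - 3, by omega⟩, Fin.ext ?_⟩
    change v.val - 3 + 3 = v.val
    omega

/-- The suspension embeds into the complement of a path. -/
def pathEmbedding (n : ℕ) : join (⊥ : SimpleGraph (Fin 2)) (pathGraph n)ᶜ ↪g (pathGraph (n + 3))ᶜ :=
  suspensionEmbedding
    (fun i j hi hj => by simp [pathGraph_adj, Fin.ext_iff]; omega)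
    (fun i j hi hj => by simp [pathGraph_adj, Fin.ext_iff]; omega)
    (fun i j => by simp [pathGraph_adj, Fin.ext_iff])

/-- In the complement, vertex 0 misses only 1, which 2 misses as well. -/
theorem pathEmbedding_dominated (n : ℕ) : ∀ v ∉ Set.range (pathEmbedding n), ∃ a,
    (pathGraph (n + 3))ᶜ.Adj v (pathEmbedding n a) ∧ ∀ z, (pathGraph (n + 3))ᶜ.Adj v z →
      z ≠ pathEmbedding n a → (pathGraph (n + 3))ᶜ.Adj (pathEmbedding n a) z := by
  intro v hv
  obtain rfl := eq_two_of_notMem_range hv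
  refine ⟨.inl 0, ?_⟩
  rw [show pathEmbedding n (.inl 0) = 0 from rfl]
  have h2 : (2 : Fin (n + 3)).val = 2 := rfl
  simp only [compl_adj, pathGraph_adj, ne_eq, Fin.ext_iff, h2, Fin.val_zero]
  exact ⟨by omega, fun z hz => by omega⟩

theorem compl_pathGraph_homotopic (n : ℕ) :
    Homotopic (pathGraph (n + 3))ᶜ (join (⊥ : SimpleGraph (Fin 2)) (pathGraph n)ᶜ) :=
  homotopic_of_dominated _ (pathEmbedding_dominated n)

/-- The complement of a path with `3 k + 1` vertices is contractible. -/
theorem contractible_compl_pathGraph (k : ℕ) : Contractible (pathGraph (3 * k + 1))ᶜ := by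
  induction k with
  | zero => exact .point _ 0 fun y => Fin.ext (by omega)
  | succ k ih =>
    exact contractible_of_dominated _ (pathEmbedding_dominated _)
      ((ih.join _).of_iso (joinComm _ _))

theorem cycleGraph_adj_iff {n : ℕ} (hn : 2 ≤ n) (u v : Fin n) :
    (cycleGraph n).Adj u v ↔ u.val + 1 = v.val ∨ v.val + 1 = u.val ∨
      (u.val = 0 ∧ v.val + 1 = n) ∨ (v.val = 0 ∧ u.val + 1 = n) := by
  rw [cycleGraph_adj', Fin.sub_def, Fin.sub_def]
  have hu := u.2
  have hv := v.2
  simp only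
  have key : ∀ a b : ℕ, a < n → b < n →
      ((n - b + a) % n = 1 ↔ b + 1 = a ∨ (a = 0 ∧ b + 1 = n)) := by
    intro a b ha hb
    rcases le_or_gt b a with h | h
    · rw [show n - b + a = (a - b) + n by omega, Nat.add_mod_right, Nat.mod_eq_of_lt (by omega)]
      omega
    · rw [Nat.mod_eq_of_lt (by omega)]
      omega
  rw [key _ _ hu hv, key _ _ hv hu]
  tauto

/-- In terms of non-edges: the chord from 3 to `n + 2` is added, then the edge from `n + 2` to 0 is
removed. This leaves an `n`-cycle on `3, …, n + 2` with the tail 0, 1, 2 hanging at 3, and deleting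
2 separates the pair 0, 1. The bound keeps 3 and `n + 2` distinct. -/
theorem compl_cycleGraph_homotopic {n : ℕ} (hn : 2 ≤ n) :
    Homotopic (cycleGraph (n + 3))ᶜ (join (⊥ : SimpleGraph (Fin 2)) (cycleGraph n)ᶜ) := by
  let G₁ : SimpleGraph (Fin (n + 3)) :=
    { Adj := fun u v => u ≠ v ∧ ¬ (u.val + 1 = v.val ∨ v.val + 1 = u.val ∨
        (u.val = 0 ∧ v.val = n + 2) ∨ (v.val = 0 ∧ u.val = n + 2) ∨
        (u.val = 3 ∧ v.val = n + 2) ∨ (v.val = 3 ∧ u.val = n + 2))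
      symm := ⟨fun u v h => ⟨h.1.symm, by omega⟩⟩
      loopless := ⟨fun u h => h.1 rfl⟩ }
  let G₂ : SimpleGraph (Fin (n + 3)) :=
    { Adj := fun u v => u ≠ v ∧ ¬ (u.val + 1 = v.val ∨ v.val + 1 = u.val ∨
        (u.val = 3 ∧ v.val = n + 2) ∨ (v.val = 3 ∧ u.val = n + 2))
      symm := ⟨fun u v h => ⟨h.1.symm, by omega⟩⟩
      loopless := ⟨fun u h => h.1 rfl⟩ }
  have h0 : (0 : Fin (n + 3)).val = 0 := rfl
  have h1 : (1 : Fin (n + 3)).val = 1 := rfl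
  have h2 : (2 : Fin (n + 3)).val = 2 := rfl
  have hG₁ : ∀ u v, G₁.Adj u v ↔ u.val ≠ v.val ∧ ¬ (u.val + 1 = v.val ∨ v.val + 1 = u.val ∨
        (u.val = 0 ∧ v.val = n + 2) ∨ (v.val = 0 ∧ u.val = n + 2) ∨
        (u.val = 3 ∧ v.val = n + 2) ∨ (v.val = 3 ∧ u.val = n + 2)) := by
    intro u v; simp only [G₁, ne_eq, Fin.ext_iff]
  have hG₂ : ∀ u v, G₂.Adj u v ↔ u.val ≠ v.val ∧ ¬ (u.val + 1 = v.val ∨ v.val + 1 = u.val ∨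
        (u.val = 3 ∧ v.val = n + 2) ∨ (v.val = 3 ∧ u.val = n + 2)) := by
    intro u v; simp only [G₂, ne_eq, Fin.ext_iff]
  have e₁ : Homotopic G₁ (cycleGraph (n + 3))ᶜ := by
    -- Vertex 1 misses only 0 and 2, and neither is a common neighbour of `n + 2` and 3.
    refine homotopic_of_add_edge (Fin.last (n + 2)) ⟨3, by omega⟩ 1 ?_ ?_ ?_ ?_ ?_ <;>
      simp only [compl_adj, cycleGraph_adj_iff (show 2 ≤ n + 3 by omega), hG₁, ne_eq, Fin.ext_iff,
        h1, Fin.val_last] <;> grind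
  have e₂ : Homotopic G₁ G₂ := by
    -- Vertex 2 misses only 1 and 3, and neither is a common neighbour of `n + 2` and 0.
    refine homotopic_of_add_edge (Fin.last (n + 2)) 0 2 ?_ ?_ ?_ ?_ ?_ <;>
      simp only [hG₁, hG₂, ne_eq, Fin.ext_iff, h0, h2, Fin.val_last] <;> grind
  refine e₁.symm.trans (e₂.trans ?_)
  let f : join (⊥ : SimpleGraph (Fin 2)) (cycleGraph n)ᶜ ↪g G₂ := suspensionEmbedding
    (fun i j hi hj => by rw [hG₂]; omega)
    (fun i j hi hj => by rw [hG₂]; omega)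
    (fun i j => by
      simp only [compl_adj, hG₂, cycleGraph_adj_iff hn, ne_eq, Fin.ext_iff, Fin.val_addNat]
      omega)
  refine homotopic_of_dominated f fun v hv => ?_
  obtain rfl := eq_two_of_notMem_range hv
  refine ⟨.inl 0, ?_⟩
  rw [show f (.inl 0) = 0 from rfl]
  simp only [hG₂, ne_eq, Fin.ext_iff, h2, h0]
  exact ⟨by omega, fun z hz => by omega⟩

/-- The complement is two disjoint edges, each of which shrinks to a point. -/
theorem compl_cycleGraph_four_homotopic :
    Homotopic (cycleGraph 4)ᶜ (⊥ : SimpleGraph (Fin 2)) := by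
  have h : ∀ u v, (cycleGraph 4)ᶜ.Adj u v ↔ u.val + 2 = v.val ∨ v.val + 2 = u.val := by
    intro u v
    rw [compl_adj, cycleGraph_adj_iff (by norm_num), ne_eq, Fin.ext_iff]
    omega
  let f : (⊥ : SimpleGraph (Fin 2)) ↪g (cycleGraph 4)ᶜ :=
    { toFun := fun i => ⟨i, by omega⟩
      inj' := fun i j hij => by simpa [Fin.ext_iff] using hij
      map_rel_iff' := by
        intro i j
        refine iff_of_false ?_ id
        rw [h]
        change ¬ (i.val + 2 = j.val ∨ j.val + 2 = i.val)
        omega }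
  refine homotopic_of_dominated f fun v hv => ?_
  have hv2 : 2 ≤ v.val := by
    by_contra hlt
    exact hv ⟨⟨v, by omega⟩, rfl⟩
  refine ⟨⟨v - 2, by omega⟩, ?_, fun z => ?_⟩
  · rw [h]
    change v.val + 2 = v.val - 2 ∨ v.val - 2 + 2 = v.val
    omega
  · rw [h, h, ne_eq, Fin.ext_iff]
    change _ → ¬ z.val = v.val - 2 → v.val - 2 + 2 = z.val ∨ z.val + 2 = v.val - 2
    omega

/-! ### Joining one component to a bouquet -/

section Components
variable {V : Type} [Finite V] {c w : ℕ} {G : SimpleGraph V}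

/-- Moving a factor of a join past a suspension. -/
def joinBotJoin {U W K : Type*} (A : SimpleGraph K) (B : SimpleGraph U) (C : SimpleGraph W) :
    join (join A B) C ≃g join B (join A C) :=
  (joinCongr (joinComm A B) .refl).trans (joinAssoc B A C)

theorem IsBouquet.join_path (h : IsBouquet c w G) (n : ℕ) (hn : n % 3 ≠ 1) :
    IsBouquet c (w + (n + 1) / 3) (join (pathGraph n)ᶜ G) := by
  induction n using Nat.strong_induction_on generalizing w V with
  | _ n ih =>
  match n, hn, ih with
  | 0, _, _ => exact h.of_iso (joinEmpty _ _)
  | 2, _, _ =>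
    rw [show (pathGraph 2)ᶜ = ⊥ by rw [pathGraph_two_eq_top, compl_top]]
    exact h.join_two
  | n + 3, hn, ih =>
    rw [show w + (n + 3 + 1) / 3 = (w + 1) + (n + 1) / 3 by omega]
    -- The suspension is absorbed into `G`, so the induction must allow `G` and `w` to vary.
    refine (ih n (by omega) h.join_two (by omega)).of_homotopic ?_ (by omega)
    exact ((compl_pathGraph_homotopic n).join_right G).trans (.iso (joinBotJoin _ _ _))

theorem IsBouquet.join_cycle (h : IsBouquet c w G) (n : ℕ) (hn : 2 ≤ n) :
    IsBouquet (c + if 3 ∣ n then 1 else 0) (w + (n + 1) / 3) (join (cycleGraph n)ᶜ G) := by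
  induction n using Nat.strong_induction_on generalizing w V with
  | _ n ih =>
  match n, hn, ih with
  | 2, _, _ =>
    -- `cycleGraph 2` is a single edge; it is where the reduction of the 5-cycle ends.
    rw [show (cycleGraph 2)ᶜ = ⊥ by rw [cycleGraph_two_eq_top, compl_top]]
    exact h.join_two
  | 3, _, _ =>
    rw [show (cycleGraph 3)ᶜ = ⊥ by rw [cycleGraph_three_eq_top, compl_top]]
    exact h.join_three
  | 4, _, _ =>
    exact h.join_two.of_homotopic (compl_cycleGraph_four_homotopic.join_right G) (by omega)
  | n + 5, hn, ih =>
    rw [show w + (n + 5 + 1) / 3 = (w + 1) + (n + 2 + 1) / 3 by omega,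
      show (if 3 ∣ n + 5 then 1 else 0) = if 3 ∣ n + 2 then 1 else 0 by
        congr 1; exact propext (by omega)]
    refine (ih (n + 2) (by omega) h.join_two (by omega)).of_homotopic ?_ (by omega)
    exact ((compl_cycleGraph_homotopic (n := n + 2) (by omega)).join_right G).trans
      (.iso (joinBotJoin _ _ _))

end Components

/-! ### Families of components -/

section Families

theorem disjointUnion_adj {ι : Type u} {V : ι → Type v} (H : ∀ i, SimpleGraph (V i))
    (x y : Σ i, V i) : (disjointUnion H).Adj x y ↔ ∃ h : x.1 = y.1, (H y.1).Adj (h ▸ x.2) y.2 := by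
  constructor
  · rintro ⟨i, a, b, rfl, rfl, h⟩
    exact ⟨rfl, h⟩
  · obtain ⟨i, a⟩ := x
    obtain ⟨j, b⟩ := y
    rintro ⟨h, hab⟩
    obtain rfl : i = j := h
    exact ⟨i, a, b, rfl, rfl, hab⟩

theorem compl_disjointUnion {ι : Type u} {V : ι → Type v} (H : ∀ i, SimpleGraph (V i)) :
    (disjointUnion H)ᶜ = zykovJoin fun i => (H i)ᶜ := by
  ext ⟨i, a⟩ ⟨j, b⟩
  rw [zykovJoin, sup_adj, compl_adj]
  by_cases h : i = j
  · subst h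
    simp [disjointUnion_adj]
  · simp [disjointUnion_adj, h]

/-- Reindexing of a disjoint union. -/
def disjointUnionReindex {ι κ : Type u} {V : κ → Type v} (e : ι ≃ κ)
    (H : ∀ k, SimpleGraph (V k)) :
    disjointUnion (fun i => H (e i)) ≃g disjointUnion H where
  toEquiv := e.sigmaCongrLeft
  map_rel_iff' := by
    rintro ⟨i, a⟩ ⟨j, b⟩
    by_cases h : i = j
    · subst h
      simp [disjointUnion_adj]
    · simp [disjointUnion_adj, h]

/-- Isomorphic graphs have isomorphic complements. -/
def complIso {V W : Type*} {G : SimpleGraph V} {H : SimpleGraph W} (e : G ≃g H) : Gᶜ ≃g Hᶜ where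
  toEquiv := e.toEquiv
  map_rel_iff' := by
    intro a b
    have h : H.Adj (e a) (e b) ↔ G.Adj a b := e.map_adj_iff
    simp [h]

/-- The complement of a disjoint union indexed by `Fin (n + 1)`, as a join. -/
def complDisjointUnionSucc {n : ℕ} {V : Fin (n + 1) → Type} (H : ∀ i, SimpleGraph (V i)) :
    (disjointUnion H)ᶜ ≃g join (H 0)ᶜ (disjointUnion fun i : Fin n => H i.succ)ᶜ where
  toFun x := Fin.cases (motive := fun i => V i → V 0 ⊕ Σ i : Fin n, V i.succ) .inl
    (fun i a => .inr ⟨i, a⟩) x.1 x.2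
  invFun := Sum.elim (fun a => ⟨0, a⟩) fun x => ⟨x.1.succ, x.2⟩
  left_inv := by
    rintro ⟨i, a⟩
    cases i using Fin.cases <;> rfl
  right_inv := by rintro (a | ⟨i, a⟩) <;> rfl
  map_rel_iff' := by
    rintro ⟨i, a⟩ ⟨j, b⟩
    cases i using Fin.cases with
    | zero =>
      cases j using Fin.cases with
      | zero => simp [disjointUnion_adj]
      | succ j => simp [disjointUnion_adj, (Fin.succ_ne_zero _).symm]
    | succ i =>
      cases j using Fin.cases with
      | zero => simp [disjointUnion_adj]
      | succ j =>
        by_cases h : i = j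
        · subst h
          simp [disjointUnion_adj]
        · simp [disjointUnion_adj, h]

theorem PathOrCycle.isBouquet_join (K : PathOrCycle) (hK : K.IsPath → ¬ 3 ∣ K.length)
    {V : Type} [Finite V] {c w : ℕ} {G : SimpleGraph V} (h : IsBouquet c w G)
    [Decidable (K.IsCycle ∧ 3 ∣ K.length)] :
    IsBouquet (c + if K.IsCycle ∧ 3 ∣ K.length then 1 else 0) (w + K.weight)
      (join K.graphᶜ G) := by
  cases K with
  | path l =>
    have hl : ¬ 3 ∣ l := hK trivial
    rw [if_neg fun h => h.1]
    -- `join_path` counts vertices, so `3 ∣ l` is its excluded residue 1.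
    exact h.join_path (l + 1) (by omega)
  | cycle n hn =>
    have := h.join_cycle n (by omega)
    by_cases hn3 : 3 ∣ n
    · rw [if_pos ⟨trivial, hn3⟩]
      rwa [if_pos hn3] at this
    · rw [if_neg fun h => hn3 h.2]
      rwa [if_neg hn3] at this

open Classical in
theorem isBouquet_compl_disjointUnion {n : ℕ} (C : Fin n → PathOrCycle)
    (hC : ∀ i, (C i).IsPath → ¬ 3 ∣ (C i).length) :
    IsBouquet (∑ i, if (C i).IsCycle ∧ 3 ∣ (C i).length then 1 else 0) (∑ i, (C i).weight)
      (disjointUnion fun i => (C i).graph)ᶜ := by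
  induction n with
  -- The empty family gives the empty graph, the `(-1)`-sphere.
  | zero => exact ⟨rfl, ⟨fun x => x.1.elim0⟩⟩
  | succ n ih =>
    rw [Fin.sum_univ_succ, Fin.sum_univ_succ, add_comm (ite _ _ _), add_comm (C 0).weight]
    exact ((C 0).isBouquet_join (hC 0) (ih (fun i => C i.succ) fun i => hC i.succ)).of_iso
      (complDisjointUnionSucc _)

theorem contractible_compl_disjointUnion {n : ℕ} (C : Fin n → PathOrCycle)
    (hC : ∃ i, (C i).IsPath ∧ 3 ∣ (C i).length) :
    Contractible (disjointUnion fun i => (C i).graph)ᶜ := by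
  induction n with
  | zero => exact hC.choose.elim0
  | succ n ih =>
    refine .of_iso ?_ (complDisjointUnionSucc _).symm
    obtain ⟨i, hi⟩ := hC
    cases i using Fin.cases with
    | zero =>
      refine .join ?_ _
      generalize C 0 = K at hi
      cases K with
      | path l =>
        obtain ⟨k, rfl : l = 3 * k⟩ := hi.2
        exact contractible_compl_pathGraph k
      | cycle n hn => exact hi.1.elim
    | succ i => exact ((ih (fun i => C i.succ) ⟨i, hi⟩).join _).of_iso (joinComm _ _)

theorem PathOrCycle.weight_ne_zero (K : PathOrCycle) (hK : K.IsPath → ¬ 3 ∣ K.length) :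
    K.weight ≠ 0 := by
  cases K with
  | path l =>
    have hl : ¬ 3 ∣ l := hK trivial
    change (l + 2) / 3 ≠ 0
    omega
  | cycle n hn =>
    change (n + 1) / 3 ≠ 0
    omega

end Families

end GraphHomotopy

open GraphHomotopy in
-- Every weight is positive here and the family is nonempty, so the total weight is a successor and
-- `d` exists.
theorem exists_isBouquet_compl {ι : Type} [Fintype ι] [Nonempty ι]
    (C : ι → PathOrCycle) {V : Type} (G : SimpleGraph V)
    (e : G ≃g disjointUnion (fun i => (C i).graph))
    (hC : ∀ i, (C i).IsPath → ¬ 3 ∣ (C i).length) :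
    ∃ d : ℕ, d + 1 = ∑ i, (C i).weight ∧
      IsBouquet (Nat.card {i // (C i).IsCycle ∧ 3 ∣ (C i).length}) (d + 1) Gᶜ := by
  classical
  have hpos : ∑ i, (C i).weight ≠ 0 := by
    obtain ⟨i⟩ := ‹Nonempty ι›
    intro h
    exact (C i).weight_ne_zero (hC i) (Finset.sum_eq_zero_iff.1 h i (Finset.mem_univ i))
  obtain ⟨d, hd⟩ := Nat.exists_eq_succ_of_ne_zero hpos
  refine ⟨d, hd.symm, ?_⟩
  let ε := (Fintype.equivFin ι).symm
  have h := (isBouquet_compl_disjointUnion (fun i => C (ε i)) fun i => hC (ε i)).of_iso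
    (complIso (e.trans (disjointUnionReindex ε fun i => (C i).graph).symm))
  rw [ε.sum_comp fun i => (C i).weight,
    ε.sum_comp fun i => if (C i).IsCycle ∧ 3 ∣ (C i).length then 1 else 0, hd,
    ← Finset.card_filter] at h
  rwa [Nat.card_eq_fintype_card, Fintype.card_subtype]

theorem mainTheorem7 {ι : Type} [Fintype ι] [Nonempty ι]
    (C : ι → GraphHomotopy.PathOrCycle) {V : Type} (G : SimpleGraph V)
    (e : G ≃g GraphHomotopy.disjointUnion (fun i => (C i).graph)) :
    -- complements turn disjoint unions into Zykov joins
    (∀ (κ : Type) (W : κ → Type) (H : ∀ k, SimpleGraph (W k)),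
      (GraphHomotopy.disjointUnion H)ᶜ = GraphHomotopy.zykovJoin (fun k => (H k)ᶜ)) ∧
    -- no length divisible by 3: a `d`-sphere
    ((∀ i, ¬ 3 ∣ (C i).length) →
      ∃ d : ℕ, d + 1 = ∑ i, (C i).weight ∧
        GraphHomotopy.Homotopic Gᶜ (GraphHomotopy.sphere d)) ∧
    -- some path of length divisible by 3: contractible
    ((∃ i, (C i).IsPath ∧ 3 ∣ (C i).length) →
      GraphHomotopy.Contractible Gᶜ) ∧
    -- no path of length divisible by 3: a wedge sum of `d`-spheres
    ((∀ i, (C i).IsPath → ¬ 3 ∣ (C i).length) →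
      ∃ d : ℕ, d + 1 = ∑ i, (C i).weight ∧
        GraphHomotopy.Homotopic Gᶜ
          (GraphHomotopy.wedgeOfSpheres
            (2 ^ Nat.card {i // (C i).IsCycle ∧ 3 ∣ (C i).length}) d)) := by
  refine ⟨fun κ W H => GraphHomotopy.compl_disjointUnion H, fun h => ?_, fun ⟨i, hi⟩ => ?_,
    fun h => ?_⟩
  · obtain ⟨d, hd, hG⟩ := exists_isBouquet_compl C G e fun i _ => h i
    -- With no cycle length divisible by 3 the bouquet has `2 ^ 0 = 1` sphere.
    have : IsEmpty {i // (C i).IsCycle ∧ 3 ∣ (C i).length} := ⟨fun i => h i i.2.2⟩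
    rw [Nat.card_of_isEmpty] at hG
    exact ⟨d, hd, hG.homotopic_sphere⟩
  · let ε := (Fintype.equivFin ι).symm
    refine (GraphHomotopy.contractible_compl_disjointUnion (fun i => C (ε i))
      ⟨ε.symm i, by simpa using hi⟩).of_iso (GraphHomotopy.complIso
        (e.trans (GraphHomotopy.disjointUnionReindex ε fun i => (C i).graph).symm)).symm
  · obtain ⟨d, hd, hG⟩ := exists_isBouquet_compl C G e h
    exact ⟨d, hd, hG.homotopic_wedgeOfSpheres⟩
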